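/- Let $\{\varphi_j\}_{j\ge 1}$ be an orthonormal basis of the real space $L^2([0,1])$ that is $B_0$-uniformly bounded, i.e. $\sup_j\sup_{x\in[0,1]}|\varphi_j(x)|\le B_0<\infty$. For $\beta>1/2$ and a radius $C$ let $$\mathcal F_\beta[C]=\Big\{f\in L^2([0,1]) : f=\sum_{j\ge1}\theta_j\varphi_j,\ \sum_{j\ge 1}j^{2\beta}\theta_j^2\le C^2\Big\},\qquad \theta_j=\int_0^1 f\varphi_j .$$ For $\alpha>0$, $d\ge 1$, $r>0$, $B>0$ and $v\in\mathbb R^d$ with $\|v\|_\infty\le r$, the hypercube sampling scheme (Strategy B) started from $v$ generates $Z\in\{-B,B\}^d$ as follows: sample the coordinates $\tilde v_j\in\{-r,r\}$ independently with $P(\tilde v_j=r)=\frac12+\frac{v_j}{2r}$; then let $Z$ be uniform on $\{z\in\{-B,B\}^d:\langle z,\tilde v\rangle>0\}$ with probability $\frac{e^\alpha}{e^\alpha+1}$, and uniform on $\{z\in\{-B,B\}^d:\langle z,\tilde v\rangle\le 0\}$ with probability $\frac1{e^\alpha+1}$. For every $k\ge1$ and $\alpha>0$ there is a constant $c_k=c_k(\alpha)>0$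 such that, for $d=k$ and all such $r,B,v$ and all $j$, $$E[Z_j\mid v]=c_k\,\frac{B}{r\sqrt k}\Big(\frac{e^\alpha}{e^\alpha+1}-\frac1{e^\alpha+1}\Big)v_j .$$ Given $X_1,\dots,X_n$ drawn i.i.d. from a probability density $f$ on $[0,1]$, independently for each $i$ sample $Z_i\in\mathbb R^k$ by this scheme started from $v=(\varphi_1(X_i),\dots,\varphi_k(X_i))$, with $r=B_0$ and $B=B_0\sqrt k\,(e^\alpha+1)/(c_k(e^\alpha-1))$ (so that $E[Z_{i,j}\mid X_i]=\varphi_j(X_i)$), and put $$\hat f=\frac1n\sum_{i=1}^n\sum_{j=1}^k Z_{i,j}\,\varphi_j .$$ For all $C$, $B_0$ and $\alpha_0>0$ there is a constant $c$, depending only on $C$, $B_0$ and $\alpha_0$ (hence only on $C$ and $B_0$ in the usual range $\alpha\in(0,1]$), such that for every $\beta>1/2$, every $B_0$-uniformly bounded orthonormal basis of $L^2([0,1])$, every probability density $f\in\mathcal F_\beta[C]$, every $n$ and every $\alpha\in(0,\alpha_0]$ with $n\alpha^2\ge1$, the estimator $\hat f$ with $k=(n\alpha^2)^{1/(2\beta+2)}$,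 rounded up or down to an integer, satisfies $$E_f\big[\|f-\hat f\|_2^2\big]\le c\,(n\alpha^2)^{-\frac{2\beta}{2\beta+2}} .$$ -/

import Mathlib

open MeasureTheory ProbabilityTheory

noncomputable section

/-- Lebesgue measure on the interval `[0, 1]`. -/
abbrev unitMeasure : Measure ℝ := volume.restrict (Set.Icc (0 : ℝ) 1)

/-- The functions `φ 0, φ 1, …` are an orthonormal basis of the real Hilbert space `L²([0, 1])`:
their classes form a Hilbert basis. The function written `φ j` here is the `(j + 1)`-st basis
function. -/
def IsOrthonormalBasisL2 (φ : ℕ → ℝ → ℝ) : Prop :=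
  ∃ b : HilbertBasis ℕ ℝ (Lp ℝ 2 unitMeasure), ∀ j, ⇑(b j) =ᵐ[unitMeasure] φ j

/-- Basis coefficient `θ_j = ∫₀¹ f φ_j`. -/
def basisCoeff (φ : ℕ → ℝ → ℝ) (f : ℝ → ℝ) (j : ℕ) : ℝ :=
  ∫ x in Set.Icc (0 : ℝ) 1, f x * φ j x

/-- The elliptical Sobolev class of order `β` and radius `C` for the basis `φ`: square-integrable
functions with `∑_{j ≥ 1} j^{2β} θ_j² ≤ C²` (the index is shifted by one; the sum of non-negative
terms is taken in `[0, ∞]`). -/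
def sobolevClass (φ : ℕ → ℝ → ℝ) (β C : ℝ) : Set (ℝ → ℝ) :=
  {f | MemLp f 2 unitMeasure ∧
    ∑' j : ℕ, ENNReal.ofReal (((j : ℝ) + 1) ^ (2 * β) * basisCoeff φ f j ^ 2)
      ≤ ENNReal.ofReal (C ^ 2)}

/-- `f` is a probability density with respect to Lebesgue measure on `[0, 1]`. -/
structure IsUnitDensity (f : ℝ → ℝ) : Prop where
  nonneg : ∀ x ∈ Set.Icc (0 : ℝ) 1, 0 ≤ f x
  integrable : Integrable f unitMeasure
  integral_eq_one : ∫ x in Set.Icc (0 : ℝ) 1, f x = 1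

/-- The distribution on `[0, 1]` with density `f`. -/
def densityLaw (f : ℝ → ℝ) : Measure ℝ :=
  unitMeasure.withDensity fun x => ENNReal.ofReal (f x)

/-- The scaled hypercube `{-r, r}^d`. -/
def cube (d : ℕ) (r : ℝ) : Finset (Fin d → ℝ) :=
  Fintype.piFinset fun _ => {-r, r}

/-- The rounding of `t ∈ [-r, r]` to `{-r, r}`: the value `s = r` has probability
`1/2 + t/(2r)`, the value `s = -r` has probability `1/2 - t/(2r)`. -/
def roundProb (r t s : ℝ) : ℝ :=
  if s = r then 1 / 2 + t / (2 * r) else 1 / 2 - t / (2 * r)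

/-- The probability `π_α = e^α / (e^α + 1)`. -/
def privacyProb (α : ℝ) : ℝ := Real.exp α / (Real.exp α + 1)

/-- The hypercube sampling scheme (Strategy B) with privacy level `α`, radius `r` and bound `B`,
started from a vector `v` with `|v_j| ≤ r`: the law of `Z ∈ {-B, B}^d`, where the coordinates of `v`
are first rounded independently to give `w ∈ {-r, r}^d`, and then `Z` is uniform on
`{z ∈ {-B, B}^d : ⟨z, w⟩ > 0}` with probability `π_α` and uniform on
`{z ∈ {-B, B}^d : ⟨z, w⟩ ≤ 0}` with probability `1 - π_α`. -/
def strategyB {d : ℕ} (α r B : ℝ) (v : Fin d → ℝ) : Measure (Fin d → ℝ) :=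
  ∑ w ∈ cube d r, ENNReal.ofReal (∏ j, roundProb r (v j) (w j)) •
    (ENNReal.ofReal (privacyProb α) • uniformOn {z | z ∈ cube d B ∧ 0 < ∑ j, z j * w j} +
      ENNReal.ofReal (1 - privacyProb α) • uniformOn {z | z ∈ cube d B ∧ ∑ j, z j * w j ≤ 0})

/-- `c` is the constant `c_k` (for the dimension `k` and the privacy level `α`) in the formula
`E[Z_j | v] = c_k · B / (r √k) · (e^α/(e^α+1) - 1/(e^α+1)) · v_j` for the conditional mean of the
hypercube sampling scheme. -/
def IsChannelConstant (k : ℕ) (α c : ℝ) : Prop :=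
  0 < c ∧ ∀ r B : ℝ, 0 < r → 0 < B → ∀ v : Fin k → ℝ, (∀ j, |v j| ≤ r) → ∀ j,
    ∫ z, z j ∂(strategyB α r B v) =
      c * (B / (r * √(k : ℝ))) *
        (Real.exp α / (Real.exp α + 1) - 1 / (Real.exp α + 1)) * v j

/-- The outer bound `B = B₀ √k (e^α + 1) / (c_k (e^α - 1))`. -/
def outerBound (k : ℕ) (α B₀ c : ℝ) : ℝ :=
  B₀ * √(k : ℝ) * (Real.exp α + 1) / (c * (Real.exp α - 1))

/-- The law of one private vector `Z`: draw `X` with density `f`, set `v = (φ_1(X), …, φ_k(X))`, and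
draw `Z` by the hypercube sampling scheme with radius `B₀` and bound `B`, started from `v`. -/
def privateLaw (φ : ℕ → ℝ → ℝ) (f : ℝ → ℝ) (k : ℕ) (α B₀ B : ℝ) : Measure (Fin k → ℝ) :=
  (densityLaw f).bind fun x => strategyB α B₀ B fun j : Fin k => φ j x

/-- The orthogonal series estimator `(1/n) ∑_{i ≤ n} ∑_{j ≤ k} Z_{i,j} φ_j`. -/
def seriesEstimator (φ : ℕ → ℝ → ℝ) {n k : ℕ} (Z : Fin n → Fin k → ℝ) (x : ℝ) : ℝ :=
  1 / (n : ℝ) * ∑ i, ∑ j, Z i j * φ j x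

/-- Mean squared `L²([0, 1])` error (an element of `[0, ∞]`) of the series estimator computed from
`n` independent private vectors, each sampled from its own draw from the density `f`. -/
def privateMSE (φ : ℕ → ℝ → ℝ) (f : ℝ → ℝ) (n k : ℕ) (α B₀ B : ℝ) : ENNReal :=
  ∫⁻ Z, (∫⁻ x, ENNReal.ofReal ((f x - seriesEstimator φ Z x) ^ 2) ∂unitMeasure)
    ∂(Measure.pi fun _ : Fin n => privateLaw φ f k α B₀ B)

end

/-! The risk splits into variance and bias. By Parseval (`lintegral_sq_sub_sum`) the integrated
squared error is the sum of the `k` squared coefficient errors plus the tail of the squared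
coefficients of `f`. The tail is at most `(k+1)^(-2β) C²` by the Sobolev condition. Each estimated
coefficient is an average of `n` independent unbiased variables with values in `[-B, B]`, so it
costs at most `B²/n`, and the variance is at most `k B²/n`.

What remains is `B² ≲ k/α²`, that is, a lower bound on `c_k` uniform in `k` and `α`. By sign
symmetry and exchangeability of the coordinates, the mean of the channel given the rounded vector
`w` is a multiple of `w`, and rounding is unbiased; this identifies `c_k` through the sum of `∑ j, u
j` over sign vectors where it is positive, which is half of the sum of `|∑ j, u j|` over the cube. A
fourth-moment form of Khintchine's inequality (`le_posSignsTotal`) then yields `c_k ≥ 5/9`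
(`five_ninths_le_channelConstant`). Hence the risk is of order `k²/(nα²) + k^(-2β)`, and the stated
`k` balances the two terms. -/

/-! ### Sign vectors: moments, symmetries and a Khintchine bound -/

lemma mem_cube {d : ℕ} {r : ℝ} {z : Fin d → ℝ} : z ∈ cube d r ↔ ∀ j, z j = -r ∨ z j = r := by
  simp [cube]

lemma sum_pair_neg {r : ℝ} (hr : 0 < r) (g : ℝ → ℝ) :
    ∑ s ∈ ({-r, r} : Finset ℝ), g s = g (-r) + g r :=
  Finset.sum_pair (by linarith)

/-- The sign vectors in `{-1, 1}^d` with positive coordinate sum. -/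
noncomputable def posSigns (d : ℕ) : Finset (Fin d → ℝ) := {u ∈ cube d 1 | 0 < ∑ j, u j}

/-- The sign vectors in `{-1, 1}^d` with nonpositive coordinate sum. -/
noncomputable def nonposSigns (d : ℕ) : Finset (Fin d → ℝ) := {u ∈ cube d 1 | ∑ j, u j ≤ 0}

/-- Splitting off one sign gives the induction step for the moments below, where odd powers cancel.
-/
lemma sum_cube_succ (d : ℕ) (g : (Fin (d + 1) → ℝ) → ℝ) :
    ∑ u ∈ cube (d + 1) 1, g u =
      ∑ u ∈ cube d 1, (g (Fin.cons (-1) u) + g (Fin.cons 1 u)) := by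
  have h : ∑ u ∈ cube (d + 1) 1, g u =
      ∑ p ∈ ({-1, 1} : Finset ℝ) ×ˢ cube d 1, g (Fin.cons p.1 p.2) := by
    symm
    refine Finset.sum_nbij' (fun p => Fin.cons p.1 p.2) (fun u => (u 0, Fin.tail u)) ?_ ?_ ?_ ?_ ?_
    · rintro ⟨s, u⟩ h
      simp only [Finset.mem_product, Finset.mem_insert, Finset.mem_singleton, mem_cube] at h
      rw [mem_cube]
      exact Fin.cases h.1 h.2
    · intro u h
      rw [mem_cube] at h
      simp only [Finset.mem_product, Finset.mem_insert, Finset.mem_singleton, mem_cube]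
      exact ⟨h 0, fun j => h j.succ⟩
    · rintro ⟨s, u⟩ _
      simp
    · intro u _
      simp
    · intros
      rfl
  rw [h, Finset.sum_product_right]
  exact Finset.sum_congr rfl fun u _ => sum_pair_neg one_pos _

lemma card_cube_one (d : ℕ) : ((cube d 1).card : ℝ) = 2 ^ d := by
  have h : ({-1, 1} : Finset ℝ).card = 2 := Finset.card_pair (by norm_num)
  simp [cube, h]

lemma sum_cube_sq (d : ℕ) : ∑ u ∈ cube d 1, (∑ j, u j) ^ 2 = 2 ^ d * (d : ℝ) := by
  induction d with
  | zero => simp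
  | succ d ih =>
    have h (u : Fin d → ℝ) : (-1 + ∑ j, u j) ^ 2 + (1 + ∑ j, u j) ^ 2 =
        2 * (∑ j, u j) ^ 2 + 2 := by ring
    simp only [sum_cube_succ, Fin.sum_univ_succ, Fin.cons_zero, Fin.cons_succ, h,
      Finset.sum_add_distrib, ← Finset.mul_sum, ih, Finset.sum_const, nsmul_eq_mul, card_cube_one]
    push_cast
    ring

lemma sum_cube_pow_four (d : ℕ) :
    ∑ u ∈ cube d 1, (∑ j, u j) ^ 4 = 2 ^ d * (3 * (d : ℝ) ^ 2 - 2 * d) := by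
  induction d with
  | zero => simp
  | succ d ih =>
    have h (u : Fin d → ℝ) : (-1 + ∑ j, u j) ^ 4 + (1 + ∑ j, u j) ^ 4 =
        2 * (∑ j, u j) ^ 4 + 12 * (∑ j, u j) ^ 2 + 2 := by ring
    simp only [sum_cube_succ, Fin.sum_univ_succ, Fin.cons_zero, Fin.cons_succ, h,
      Finset.sum_add_distrib, ← Finset.mul_sum, ih, sum_cube_sq, Finset.sum_const, nsmul_eq_mul,
      card_cube_one]
    push_cast
    ring

lemma sum_cube_neg (d : ℕ) (g : (Fin d → ℝ) → ℝ) :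
    ∑ u ∈ cube d 1, g (-u) = ∑ u ∈ cube d 1, g u := by
  refine Finset.sum_nbij' (fun u => -u) (fun u => -u) ?_ ?_ ?_ ?_ ?_
  · intro u hu
    rw [mem_cube] at *
    intro j
    rcases hu j with h | h <;> simp [h]
  · intro u hu
    rw [mem_cube] at *
    intro j
    rcases hu j with h | h <;> simp [h]
  all_goals simp

lemma sum_posSigns_add_sum_nonposSigns (d : ℕ) (g : (Fin d → ℝ) → ℝ) :
    ∑ u ∈ posSigns d, g u + ∑ u ∈ nonposSigns d, g u = ∑ u ∈ cube d 1, g u := by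
  simp only [posSigns, nonposSigns, ← not_lt]
  exact Finset.sum_filter_add_sum_filter_not _ _ _

lemma sum_nonposSigns_apply (d : ℕ) (j : Fin d) :
    ∑ u ∈ nonposSigns d, u j = -∑ u ∈ posSigns d, u j := by
  have h := sum_posSigns_add_sum_nonposSigns d fun u => u j
  have h' := sum_cube_neg d fun u => u j
  simp only [Pi.neg_apply, Finset.sum_neg_distrib] at h'
  linarith

/-- The total coordinate sum of all sign vectors with positive coordinate sum. -/
noncomputable def posSignsTotal (d : ℕ) : ℝ := ∑ u ∈ posSigns d, ∑ j, u j

/-- Swapping two coordinates preserves the coordinate sum, so all `d` coordinates contribute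
equally. -/
lemma sum_posSigns_apply (d : ℕ) (j : Fin d) :
    ∑ u ∈ posSigns d, u j = posSignsTotal d / d := by
  have h (i : Fin d) : ∑ u ∈ posSigns d, u i = ∑ u ∈ posSigns d, u j := by
    have key (u : Fin d → ℝ) (hu : u ∈ posSigns d) : u ∘ Equiv.swap i j ∈ posSigns d := by
      simp only [posSigns, Finset.mem_filter, mem_cube, Function.comp_apply] at *
      exact ⟨fun l => hu.1 _, by rw [Equiv.sum_comp (Equiv.swap i j) u]; exact hu.2⟩
    refine Finset.sum_nbij' (fun u => u ∘ Equiv.swap i j) (fun u => u ∘ Equiv.swap i j)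
      key key ?_ ?_ ?_
    · intro u _
      ext l
      simp
    · intro u _
      ext l
      simp
    · intro u _
      simp
  have hd : (d : ℝ) ≠ 0 := by
    have := j.pos
    positivity
  rw [posSignsTotal, Finset.sum_comm, Finset.sum_congr rfl fun i _ => h i]
  simp [hd]

/-- Negation makes both halves contribute equally; ties lie in `nonposSigns` but have coordinate sum
zero. -/
lemma sum_cube_abs (d : ℕ) : ∑ u ∈ cube d 1, |∑ j, u j| = 2 * posSignsTotal d := by
  rw [← sum_posSigns_add_sum_nonposSigns]
  have h1 : ∑ u ∈ posSigns d, |∑ j, u j| = posSignsTotal d :=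
    Finset.sum_congr rfl fun u hu => abs_of_pos (Finset.mem_filter.1 hu).2
  have h2 : ∑ u ∈ nonposSigns d, |∑ j, u j| = -∑ u ∈ nonposSigns d, ∑ j, u j := by
    rw [← Finset.sum_neg_distrib]
    exact Finset.sum_congr rfl fun u hu => abs_of_nonpos (Finset.mem_filter.1 hu).2
  have h3 : ∑ u ∈ nonposSigns d, ∑ j, u j = -posSignsTotal d := by
    rw [posSignsTotal, Finset.sum_comm, Finset.sum_comm (s := posSigns d),
      ← Finset.sum_neg_distrib]
    exact Finset.sum_congr rfl fun j _ => sum_nonposSigns_apply d j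
  rw [h1, h2, h3]
  ring

lemma card_posSigns_le (d : ℕ) : 2 * ((posSigns d).card : ℝ) ≤ 2 ^ d := by
  have h : (posSigns d).card ≤ (nonposSigns d).card := by
    refine Finset.card_le_card_of_injOn (fun u => -u) ?_ neg_injective.injOn
    intro u hu
    simp only [posSigns, nonposSigns, Finset.coe_filter, Set.mem_ofPred_eq, mem_cube] at *
    refine ⟨fun j => ?_, by simpa using hu.2.le⟩
    rcases hu.1 j with h | h <;> simp [h]
  have h' := sum_posSigns_add_sum_nonposSigns d fun _ => 1
  simp only [Finset.sum_const, nsmul_eq_mul, mul_one, card_cube_one] at h'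
  have : ((posSigns d).card : ℝ) ≤ (nonposSigns d).card := by exact_mod_cast h
  linarith

lemma card_posSigns_le_card_nonposSigns (d : ℕ) :
    ((posSigns d).card : ℝ) ≤ (nonposSigns d).card := by
  have h := card_posSigns_le d
  have h' := sum_posSigns_add_sum_nonposSigns d fun _ => 1
  simp only [Finset.sum_const, nsmul_eq_mul, mul_one, card_cube_one] at h'
  linarith

lemma posSigns_nonempty {d : ℕ} (hd : 0 < d) : (posSigns d).Nonempty :=
  ⟨fun _ => 1, by simp [posSigns, mem_cube, hd]⟩

lemma nonposSigns_nonempty (d : ℕ) : (nonposSigns d).Nonempty :=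
  ⟨fun _ => -1, by simp [nonposSigns, mem_cube]⟩

/-- A Khintchine-type lower bound for the first absolute moment of a sum of random signs. -/
lemma le_posSignsTotal (d : ℕ) : 5 / 18 * (2 ^ d * √(d : ℝ)) ≤ posSignsTotal d := by
  rcases Nat.eq_zero_or_pos d with rfl | hd
  · simp [posSignsTotal]
  have hd' : (0 : ℝ) < d := by exact_mod_cast hd
  have hs : 0 < √(d : ℝ) := Real.sqrt_pos.2 hd'
  have hsq : √(d : ℝ) ^ 2 = d := Real.sq_sqrt hd'.le
  -- With `t = |x|` and `s = √d`, this is `0 ≤ t (t + 3s) (2t - 3s)² = 4t⁴ - 27s²t² + 27s³t`,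
  -- divided by 27. It bounds `|x|` below by even powers, whose sums over the cube are known.
  have hpt (x : ℝ) : x ^ 2 * (d : ℝ) - 4 / 27 * x ^ 4 ≤ √(d : ℝ) ^ 3 * |x| := by
    have h := mul_nonneg (abs_nonneg x) (mul_nonneg
      (add_nonneg (abs_nonneg x) (mul_nonneg zero_le_three hs.le))
      (sq_nonneg (2 * |x| - 3 * √(d : ℝ))))
    have e4 : x ^ 4 = |x| ^ 4 := (Even.pow_abs (by decide) x).symm
    have e2 : x ^ 2 * (d : ℝ) = |x| ^ 2 * √(d : ℝ) ^ 2 := by rw [sq_abs, hsq]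
    rw [e2, e4]
    linarith
  have hsum := Finset.sum_le_sum fun u (_ : u ∈ cube d 1) => hpt (∑ j, u j)
  rw [Finset.sum_sub_distrib, ← Finset.sum_mul, ← Finset.mul_sum, ← Finset.mul_sum,
    sum_cube_sq, sum_cube_pow_four, sum_cube_abs] at hsum
  have h3 : √(d : ℝ) ^ 3 = d * √(d : ℝ) := by rw [pow_succ, hsq]
  have hdd : √(d : ℝ) * (5 / 18 * (2 ^ d * √(d : ℝ))) ≤ √(d : ℝ) * posSignsTotal d := by
    refine le_of_mul_le_mul_left ?_ hd'
    have e1 : (d : ℝ) * (√(d : ℝ) * (5 / 18 * (2 ^ d * √(d : ℝ)))) = 5 / 18 * 2 ^ d * (d * d) := by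
      calc _ = 5 / 18 * 2 ^ d * (d * √(d : ℝ) ^ 2) := by ring
        _ = _ := by rw [hsq]
    -- The left side of `hsum` is `2^d (5/9 d² + 8/27 d)`; the nonnegative linear term is dropped.
    have hp : (0 : ℝ) ≤ 2 ^ d * d := by positivity
    rw [e1]
    rw [h3] at hsum
    linarith
  exact le_of_mul_le_mul_left hdd hs

/-! ### The hypercube channel: total mass and conditional mean -/

/-- Under `z j = B (w j / r) u j` the inner product of `z` with `w` becomes `r B ∑ j, u j`. A
predicate invariant under positive scaling covers both half-cubes at once and removes the dependence
on `w`. -/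
lemma sum_filter_cube {d : ℕ} {r B : ℝ} (hr : 0 < r) (hB : 0 < B) {w : Fin d → ℝ}
    (hw : w ∈ cube d r) (p : ℝ → Prop) [DecidablePred p] (hp : ∀ c x, 0 < c → (p (c * x) ↔ p x))
    (g : (Fin d → ℝ) → ℝ) :
    ∑ z ∈ cube d B with p (∑ j, z j * w j), g z =
      ∑ u ∈ cube d 1 with p (∑ j, u j), g fun j => B * (w j / r) * u j := by
  rw [mem_cube] at hw
  have hw2 (j : Fin d) : (w j / r) * (w j / r) = 1 := by
    rcases hw j with h | h <;> rw [h] <;> field_simp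
  have hw3 (j : Fin d) : w j = r * (w j / r) := by field_simp
  have hw1 (j : Fin d) : w j / r = 1 ∨ w j / r = -1 := by
    rcases hw j with h | h <;> rw [h] <;> field_simp <;> simp
  refine Finset.sum_nbij' (fun z j => (w j / r) * z j / B) (fun u j => B * (w j / r) * u j)
    ?_ ?_ ?_ ?_ ?_
  · intro z hz
    simp only [Finset.mem_filter, mem_cube] at *
    refine ⟨fun j => ?_, ?_⟩
    · rcases hz.1 j with h | h <;> rcases hw1 j with h' | h' <;> rw [h, h'] <;> field_simp <;> simp
    · rw [← hp (r * B) _ (by positivity), Finset.mul_sum]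
      convert hz.2 using 1
      refine Finset.sum_congr rfl fun j _ => ?_
      calc r * B * (w j / r * z j / B) = r / r * (B / B) * (z j * w j) := by ring
        _ = z j * w j := by rw [div_self hr.ne', div_self hB.ne']; ring
  · intro u hu
    simp only [Finset.mem_filter, mem_cube] at *
    refine ⟨fun j => ?_, ?_⟩
    · rcases hu.1 j with h | h <;> rcases hw1 j with h' | h' <;> rw [h, h'] <;> simp
    · have : ∑ j, B * (w j / r) * u j * w j = (r * B) * ∑ j, u j := by
        rw [Finset.mul_sum]
        refine Finset.sum_congr rfl fun j _ => ?_
        calc B * (w j / r) * u j * w j = B * (w j / r) * u j * (r * (w j / r)) := by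
              rw [← hw3]
          _ = r * B * u j * ((w j / r) * (w j / r)) := by ring
          _ = _ := by rw [hw2, mul_one]
      rw [this, hp _ _ (by positivity)]
      exact hu.2
  · intro z _
    ext j
    calc B * (w j / r) * ((w j / r) * z j / B) = (w j / r) * (w j / r) * (B / B * z j) := by ring
      _ = z j := by rw [hw2, div_self hB.ne']; ring
  · intro u _
    ext j
    calc (w j / r) * (B * (w j / r) * u j) / B = (w j / r) * (w j / r) * (B / B * u j) := by ring
      _ = u j := by rw [hw2, div_self hB.ne']; ring
  · intro z _
    congr 1
    ext j
    calc z j = (w j / r) * (w j / r) * (B / B * z j) := by rw [hw2, div_self hB.ne']; ring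
      _ = B * (w j / r) * ((w j / r) * z j / B) := by ring


lemma ae_mem_uniformOn {Ω : Type*} [MeasurableSpace Ω] [MeasurableSingletonClass Ω]
    (s : Finset Ω) : ∀ᵐ z ∂(uniformOn (s : Set Ω)), z ∈ (s : Set Ω) :=
  ae_cond_mem s.measurableSet

lemma isFiniteMeasure_uniformOn {Ω : Type*} [MeasurableSpace Ω] [MeasurableSingletonClass Ω]
    (s : Finset Ω) : IsFiniteMeasure (uniformOn (s : Set Ω)) := by
  rcases s.eq_empty_or_nonempty with rfl | hs
  · simp only [Finset.coe_empty, uniformOn_empty_meas]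
    infer_instance
  · have := isProbabilityMeasure_uniformOn s.finite_toSet hs
    infer_instance

lemma integrable_uniformOn_finset {Ω : Type*} [MeasurableSpace Ω] [MeasurableSingletonClass Ω]
    (s : Finset Ω) (g : Ω → ℝ) : Integrable g (uniformOn (s : Set Ω)) := by
  have := isFiniteMeasure_uniformOn s
  have h : IntegrableOn g (s : Set Ω) (uniformOn (s : Set Ω)) := IntegrableOn.finset
  rwa [IntegrableOn, Measure.restrict_eq_self_of_ae_mem (ae_mem_uniformOn s)] at h

lemma integral_uniformOn_finset {Ω : Type*} [MeasurableSpace Ω] [MeasurableSingletonClass Ω]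
    (s : Finset Ω) (g : Ω → ℝ) :
    ∫ z, g z ∂(uniformOn (s : Set Ω)) = (∑ z ∈ s, g z) / s.card := by
  classical
  have := isFiniteMeasure_uniformOn s
  rw [← Measure.restrict_eq_self_of_ae_mem (ae_mem_uniformOn s),
    setIntegral_finset _ IntegrableOn.finset, Finset.sum_div]
  refine Finset.sum_congr rfl fun x hx => ?_
  have h : uniformOn (s : Set Ω) {x} = 1 / s.card := by
    rw [← Finset.coe_singleton, uniformOn_apply_finset, Finset.inter_singleton_of_mem hx]
    simp
  rw [Measure.real, h]
  simp [div_eq_inv_mul]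

/-- The two conditional laws mixed by the hypercube sampling scheme after rounding to `w`. -/
noncomputable def hypercubeMixture {d : ℕ} (α B : ℝ) (w : Fin d → ℝ) : Measure (Fin d → ℝ) :=
  ENNReal.ofReal (privacyProb α) • uniformOn {z | z ∈ cube d B ∧ 0 < ∑ j, z j * w j} +
    ENNReal.ofReal (1 - privacyProb α) • uniformOn {z | z ∈ cube d B ∧ ∑ j, z j * w j ≤ 0}

lemma strategyB_eq {d : ℕ} (α r B : ℝ) (v : Fin d → ℝ) :
    strategyB α r B v = ∑ w ∈ cube d r,
      ENNReal.ofReal (∏ j, roundProb r (v j) (w j)) • hypercubeMixture α B w := rfl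

lemma setOf_mem_cube_and {d : ℕ} (B : ℝ) (p : (Fin d → ℝ) → Prop) [DecidablePred p] :
    {z | z ∈ cube d B ∧ p z} = ((cube d B).filter p : Set (Fin d → ℝ)) := by
  simp

lemma ae_hypercubeMixture {d : ℕ} (α B : ℝ) (w : Fin d → ℝ) :
    ∀ᵐ z ∂hypercubeMixture α B w, z ∈ cube d B := by
  have h (p : (Fin d → ℝ) → Prop) [DecidablePred p] (c : ENNReal) :
      ∀ᵐ z ∂(c • uniformOn {z | z ∈ cube d B ∧ p z}), z ∈ cube d B := by
    rw [setOf_mem_cube_and]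
    refine Measure.ae_smul_measure ?_ c
    filter_upwards [ae_mem_uniformOn ((cube d B).filter p)] with z hz
    exact (Finset.mem_filter.1 hz).1
  rw [hypercubeMixture, ae_add_measure_iff]
  exact ⟨h _ _, h _ _⟩

lemma measurable_roundProb (r s : ℝ) : Measurable fun t => roundProb r t s := by
  unfold roundProb
  split_ifs <;> fun_prop

lemma measurable_strategyB {d : ℕ} (α r B : ℝ) :
    Measurable (strategyB α r B : (Fin d → ℝ) → Measure (Fin d → ℝ)) := by
  refine Measure.measurable_of_measurable_coe _ fun s _ => ?_
  simp only [strategyB_eq, Measure.coe_finsetSum, Finset.sum_apply, Measure.smul_apply,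
    smul_eq_mul]
  refine Finset.measurable_sum _ fun w _ => Measurable.mul_const ?_ _
  refine ENNReal.measurable_ofReal.comp (Finset.measurable_prod _ fun j _ => ?_)
  exact (measurable_roundProb r (w j)).comp (measurable_pi_apply j)

lemma ae_strategyB {d : ℕ} (α r B : ℝ) (v : Fin d → ℝ) :
    ∀ᵐ z ∂strategyB α r B v, z ∈ cube d B := by
  rw [strategyB_eq, ae_iff, Measure.coe_finsetSum, Finset.sum_apply]
  refine Finset.sum_eq_zero fun w _ => ?_
  rw [← ae_iff]
  exact Measure.ae_smul_measure (ae_hypercubeMixture α B w) _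

lemma roundProb_nonneg {r t : ℝ} (hr : 0 < r) (ht : |t| ≤ r) (s : ℝ) : 0 ≤ roundProb r t s := by
  have h := abs_le.1 ht
  have h1 : t / (2 * r) ≤ 1 / 2 := by rw [div_le_iff₀ (by positivity)]; linarith
  have h2 : -(1 / 2) ≤ t / (2 * r) := by rw [le_div_iff₀ (by positivity)]; linarith
  unfold roundProb
  split_ifs <;> linarith

lemma roundProb_self (r t : ℝ) : roundProb r t r = 1 / 2 + t / (2 * r) := if_pos rfl

lemma roundProb_neg {r : ℝ} (hr : 0 < r) (t : ℝ) : roundProb r t (-r) = 1 / 2 - t / (2 * r) :=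
  if_neg (by linarith)

lemma sum_prod_roundProb {d : ℕ} {r : ℝ} (hr : 0 < r) (v : Fin d → ℝ) :
    ∑ w ∈ cube d r, ∏ j, roundProb r (v j) (w j) = 1 := by
  rw [cube, ← Finset.prod_univ_sum (fun _ => ({-r, r} : Finset ℝ))
    (fun j s => roundProb r (v j) s)]
  refine Finset.prod_eq_one fun j _ => ?_
  rw [sum_pair_neg hr, roundProb_self, roundProb_neg hr]
  ring

/-- Unbiasedness of the rounding: in the product law, factor `i` gives its mean and every other
factor its total mass 1. -/
lemma sum_prod_roundProb_mul {d : ℕ} {r : ℝ} (hr : 0 < r) (v : Fin d → ℝ) (i : Fin d) :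
    ∑ w ∈ cube d r, (∏ j, roundProb r (v j) (w j)) * w i = v i := by
  have h (w : Fin d → ℝ) : (∏ j, roundProb r (v j) (w j)) * w i =
      ∏ j, roundProb r (v j) (w j) * (if j = i then w j else 1) := by
    rw [Finset.prod_mul_distrib, Finset.prod_ite_eq' Finset.univ i w, if_pos (Finset.mem_univ i)]
  simp only [h]
  rw [cube, ← Finset.prod_univ_sum (fun _ => ({-r, r} : Finset ℝ))
    (fun j s => roundProb r (v j) s * (if j = i then s else 1))]
  rw [Finset.prod_eq_single i]
  · rw [sum_pair_neg hr, roundProb_self, roundProb_neg hr, if_pos rfl, if_pos rfl]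
    field_simp
    ring
  · intro j _ hj
    rw [sum_pair_neg hr, roundProb_self, roundProb_neg hr, if_neg hj, if_neg hj]
    ring
  · simp

lemma privacyProb_pos (α : ℝ) : 0 < privacyProb α := by
  unfold privacyProb
  positivity

lemma one_sub_privacyProb (α : ℝ) : 1 - privacyProb α = 1 / (Real.exp α + 1) := by
  have : 0 < Real.exp α := Real.exp_pos α
  unfold privacyProb
  field_simp
  ring

lemma card_filter_cube {d : ℕ} {r B : ℝ} (hr : 0 < r) (hB : 0 < B) {w : Fin d → ℝ}
    (hw : w ∈ cube d r) (p : ℝ → Prop) [DecidablePred p] (hp : ∀ c x, 0 < c → (p (c * x) ↔ p x)) :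
    (((cube d B).filter fun z => p (∑ j, z j * w j)).card : ℝ) =
      ((cube d 1).filter fun u => p (∑ j, u j)).card := by
  simpa using sum_filter_cube hr hB hw p hp fun _ => 1

lemma pos_mul_iff_of_pos (c x : ℝ) (hc : 0 < c) : 0 < c * x ↔ 0 < x :=
  mul_pos_iff_of_pos_left hc

lemma mul_nonpos_iff_of_pos (c x : ℝ) (hc : 0 < c) : c * x ≤ 0 ↔ x ≤ 0 := by
  rw [← not_lt, ← not_lt, mul_pos_iff_of_pos_left hc]

lemma isProbabilityMeasure_hypercubeMixture {d : ℕ} (hd : 0 < d) (α : ℝ) {r B : ℝ} (hr : 0 < r)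
    (hB : 0 < B) {w : Fin d → ℝ} (hw : w ∈ cube d r) :
    IsProbabilityMeasure (hypercubeMixture α B w) := by
  have h (p : ℝ → Prop) [DecidablePred p] (hp : ∀ c x, 0 < c → (p (c * x) ↔ p x))
      (hne : ((cube d 1).filter fun u => p (∑ j, u j)).Nonempty) :
      uniformOn {z | z ∈ cube d B ∧ p (∑ j, z j * w j)} Set.univ = 1 := by
    rw [setOf_mem_cube_and]
    refine uniformOn_of_univ (Finset.finite_toSet _) ?_
    rw [Finset.coe_nonempty, ← Finset.card_pos]
    have := card_filter_cube hr hB hw p hp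
    rw [Nat.cast_inj] at this
    rwa [this, Finset.card_pos]
  constructor
  rw [hypercubeMixture, Measure.add_apply, Measure.smul_apply, Measure.smul_apply,
    h (fun x => 0 < x) pos_mul_iff_of_pos (posSigns_nonempty hd),
    h (fun x => x ≤ 0) mul_nonpos_iff_of_pos (nonposSigns_nonempty d)]
  have : 0 ≤ 1 - privacyProb α := by rw [one_sub_privacyProb]; positivity
  rw [smul_eq_mul, smul_eq_mul, mul_one, mul_one, ← ENNReal.ofReal_add (privacyProb_pos α).le this]
  simp

lemma isProbabilityMeasure_strategyB {d : ℕ} (hd : 0 < d) (α : ℝ) {r B : ℝ} (hr : 0 < r)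
    (hB : 0 < B) {v : Fin d → ℝ} (hv : ∀ j, |v j| ≤ r) :
    IsProbabilityMeasure (strategyB α r B v) := by
  constructor
  have h (w) (hw : w ∈ cube d r) :
      (ENNReal.ofReal (∏ j, roundProb r (v j) (w j)) • hypercubeMixture α B w) Set.univ =
        ENNReal.ofReal (∏ j, roundProb r (v j) (w j)) := by
    have := isProbabilityMeasure_hypercubeMixture hd α hr hB hw
    simp
  rw [strategyB_eq, Measure.coe_finsetSum, Finset.sum_apply, Finset.sum_congr rfl h,
    ← ENNReal.ofReal_sum_of_nonneg, sum_prod_roundProb hr, ENNReal.ofReal_one]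
  exact fun w _ => Finset.prod_nonneg fun j _ => roundProb_nonneg hr (hv j) _

lemma integrable_hypercubeMixture {d : ℕ} (α B : ℝ) (w : Fin d → ℝ) (g : (Fin d → ℝ) → ℝ) :
    Integrable g (hypercubeMixture α B w) := by
  rw [hypercubeMixture, setOf_mem_cube_and, setOf_mem_cube_and]
  exact ((integrable_uniformOn_finset _ g).smul_measure ENNReal.ofReal_ne_top).add_measure
    ((integrable_uniformOn_finset _ g).smul_measure ENNReal.ofReal_ne_top)

/-- The mean of the hypercube mixture in units of `B / r * w`. -/
noncomputable def mixtureSlope (d : ℕ) (α : ℝ) : ℝ :=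
  posSignsTotal d / d *
    (privacyProb α / (posSigns d).card - (1 - privacyProb α) / (nonposSigns d).card)

lemma integral_hypercubeMixture {d : ℕ} (α : ℝ) {r B : ℝ} (hr : 0 < r)
    (hB : 0 < B) {w : Fin d → ℝ} (hw : w ∈ cube d r) (i : Fin d) :
    ∫ z, z i ∂hypercubeMixture α B w = mixtureSlope d α * (B / r) * w i := by
  have hq : 0 ≤ 1 - privacyProb α := by rw [one_sub_privacyProb]; positivity
  rw [hypercubeMixture, setOf_mem_cube_and, setOf_mem_cube_and, integral_add_measure
    ((integrable_uniformOn_finset _ _).smul_measure ENNReal.ofReal_ne_top)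
    ((integrable_uniformOn_finset _ _).smul_measure ENNReal.ofReal_ne_top),
    integral_smul_measure, integral_smul_measure, integral_uniformOn_finset,
    integral_uniformOn_finset, ENNReal.toReal_ofReal hq, ENNReal.toReal_ofReal (privacyProb_pos α).le,
    card_filter_cube hr hB hw (fun x => 0 < x) pos_mul_iff_of_pos,
    card_filter_cube hr hB hw (fun x => x ≤ 0) mul_nonpos_iff_of_pos,
    sum_filter_cube hr hB hw (fun x => 0 < x) pos_mul_iff_of_pos,
    sum_filter_cube hr hB hw (fun x => x ≤ 0) mul_nonpos_iff_of_pos]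
  simp only [← Finset.mul_sum]
  change privacyProb α • (B * (w i / r) * (∑ u ∈ posSigns d, u i) / (posSigns d).card) +
    (1 - privacyProb α) • (B * (w i / r) * (∑ u ∈ nonposSigns d, u i) / (nonposSigns d).card) = _
  rw [sum_nonposSigns_apply, sum_posSigns_apply, mixtureSlope, smul_eq_mul, smul_eq_mul]
  ring

lemma integral_strategyB {d : ℕ} (α : ℝ) {r B : ℝ} (hr : 0 < r)
    (hB : 0 < B) {v : Fin d → ℝ} (hv : ∀ j, |v j| ≤ r) (i : Fin d) :
    ∫ z, z i ∂strategyB α r B v = mixtureSlope d α * (B / r) * v i := by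
  rw [strategyB_eq, integral_finsetSum_measure fun w _ =>
    (integrable_hypercubeMixture α B w _).smul_measure ENNReal.ofReal_ne_top,
    ← sum_prod_roundProb_mul hr v i, Finset.mul_sum]
  refine Finset.sum_congr rfl fun w hw => ?_
  rw [integral_smul_measure, integral_hypercubeMixture α hr hB hw, ENNReal.toReal_ofReal
    (Finset.prod_nonneg fun j _ => roundProb_nonneg hr (hv j) _), smul_eq_mul]
  ring

/-! ### The channel constant and its uniform lower bound -/

/-- The constant `c_k` of the hypercube sampling scheme. -/
noncomputable def channelConstant (k : ℕ) (α : ℝ) : ℝ :=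
  √(k : ℝ) * mixtureSlope k α / (Real.exp α / (Real.exp α + 1) - 1 / (Real.exp α + 1))

lemma privacyGap_pos {α : ℝ} (hα : 0 < α) :
    0 < Real.exp α / (Real.exp α + 1) - 1 / (Real.exp α + 1) := by
  rw [← sub_div]
  have := Real.add_one_lt_exp hα.ne'
  exact div_pos (by linarith) (by linarith)

/-- Since the positive half-cube is no larger than the other, replacing both cardinalities in
`mixtureSlope` by that of `posSigns k` can only decrease it, and the privacy gap then cancels. That
cardinality is at most `2^(k-1)`, so `le_posSignsTotal` gives `2 * (5/18) = 5/9`. -/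
lemma five_ninths_le_channelConstant {k : ℕ} (hk : 1 ≤ k) {α : ℝ} (hα : 0 < α) :
    5 / 9 ≤ channelConstant k α := by
  have hk' : (0 : ℝ) < k := by exact_mod_cast hk
  have hP : (0 : ℝ) < (posSigns k).card := by exact_mod_cast (posSigns_nonempty hk).card_pos
  have hPN := card_posSigns_le_card_nonposSigns k
  have hq : 0 ≤ 1 - privacyProb α := by rw [one_sub_privacyProb]; positivity
  have hT := le_posSignsTotal k
  have hT0 : 0 < posSignsTotal k := lt_of_lt_of_le (by positivity) hT
  rw [channelConstant, le_div_iff₀ (privacyGap_pos hα), ← one_sub_privacyProb]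
  change 5 / 9 * (privacyProb α - (1 - privacyProb α)) ≤ _
  have h1 : (privacyProb α - (1 - privacyProb α)) / (posSigns k).card ≤
      privacyProb α / (posSigns k).card - (1 - privacyProb α) / (nonposSigns k).card := by
    rw [sub_div]
    gcongr
  have h2 : 5 / 9 ≤ √(k : ℝ) * (posSignsTotal k / k) / (posSigns k).card := by
    rw [le_div_iff₀ hP]
    have h3 : √(k : ℝ) * (5 / 18 * (2 ^ k * √(k : ℝ)) / k) = 5 / 18 * 2 ^ k := by
      calc _ = 5 / 18 * 2 ^ k * (√(k : ℝ) * √(k : ℝ) / k) := by ring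
        _ = _ := by rw [Real.mul_self_sqrt hk'.le, div_self hk'.ne', mul_one]
    calc 5 / 9 * ((posSigns k).card : ℝ) ≤ 5 / 18 * 2 ^ k := by
          linarith [card_posSigns_le k]
      _ ≤ _ := by rw [← h3]; gcongr
  have hg : 0 ≤ privacyProb α - (1 - privacyProb α) := by
    rw [one_sub_privacyProb]
    exact (privacyGap_pos hα).le
  calc _ ≤ √(k : ℝ) * (posSignsTotal k / k) / (posSigns k).card *
        (privacyProb α - (1 - privacyProb α)) := by gcongr
    _ = √(k : ℝ) * (posSignsTotal k / k) *
        ((privacyProb α - (1 - privacyProb α)) / (posSigns k).card) := by ring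
    _ ≤ √(k : ℝ) * (posSignsTotal k / k) *
        (privacyProb α / (posSigns k).card - (1 - privacyProb α) / (nonposSigns k).card) := by
        gcongr
    _ = _ := by rw [mixtureSlope]; ring

lemma isChannelConstant_channelConstant {k : ℕ} (hk : 1 ≤ k) {α : ℝ} (hα : 0 < α) :
    IsChannelConstant k α (channelConstant k α) := by
  refine ⟨lt_of_lt_of_le (by norm_num) (five_ninths_le_channelConstant hk hα), ?_⟩
  intro r B hr hB v hv j
  have hk' : (0 : ℝ) < √(k : ℝ) := Real.sqrt_pos.2 (by exact_mod_cast hk)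
  have hg := (privacyGap_pos hα).ne'
  rw [integral_strategyB α hr hB hv, channelConstant]
  set g := Real.exp α / (Real.exp α + 1) - 1 / (Real.exp α + 1)
  field_simp

/-! ### Integration against a mixture of probability measures -/

section Bind

variable {X Y : Type*} [MeasurableSpace X] [MeasurableSpace Y]

lemma isProbabilityMeasure_bind_of_ae {m : Measure X} [IsProbabilityMeasure m]
    {κ : X → Measure Y} (hκ : AEMeasurable κ m) (hp : ∀ᵐ x ∂m, IsProbabilityMeasure (κ x)) :
    IsProbabilityMeasure (m.bind κ) := by
  constructor
  rw [Measure.bind_apply MeasurableSet.univ hκ]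
  have : ∫⁻ x, κ x Set.univ ∂m = ∫⁻ _, 1 ∂m :=
    lintegral_congr_ae (hp.mono fun x hx => hx.measure_univ)
  simpa using this

lemma ae_bind_of_ae_ae {m : Measure X} {κ : X → Measure Y} (hκ : AEMeasurable κ m) {s : Set Y}
    (hs : MeasurableSet s) (h : ∀ᵐ x ∂m, ∀ᵐ y ∂κ x, y ∈ s) : ∀ᵐ y ∂m.bind κ, y ∈ s := by
  rw [ae_iff]
  change m.bind κ sᶜ = 0
  rw [Measure.bind_apply hs.compl hκ, lintegral_eq_zero_of_ae_eq_zero]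
  exact h.mono fun x hx => ae_iff.1 hx

lemma abs_integral_le_of_ae_abs_le {ν : Measure Y} [IsProbabilityMeasure ν] {g : Y → ℝ} {B : ℝ}
    (hB : ∀ᵐ y ∂ν, |g y| ≤ B) : |∫ y, g y ∂ν| ≤ B := by
  simpa using norm_integral_le_of_norm_le_const (f := g) hB

lemma ofReal_integral_add_const {ν : Measure Y} [IsProbabilityMeasure ν] {g : Y → ℝ} {B : ℝ}
    (hg : AEStronglyMeasurable g ν) (hB : ∀ᵐ y ∂ν, |g y| ≤ B) :
    ENNReal.ofReal (∫ y, g y ∂ν + B) = ∫⁻ y, ENNReal.ofReal (g y + B) ∂ν := by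
  have hi : Integrable g ν := .of_bound hg B hB
  rw [← ofReal_integral_eq_lintegral_ofReal (f := fun y => g y + B) (hi.add (integrable_const B))
    (hB.mono fun y hy => by have := (abs_le.1 hy).1; simp only [Pi.zero_apply]; linarith),
    integral_add hi (integrable_const B)]
  simp

/-- Adding `B` makes the integrands nonnegative, which reduces the claim to the disintegration of
the lower integral. Almost-everywhere hypotheses suffice, as needed for a basis that is a.e.
measurable and bounded only on `[0, 1]`. -/
lemma integral_bind_of_bounded {m : Measure X} [IsProbabilityMeasure m] {κ : X → Measure Y}
    (hκ : AEMeasurable κ m) (hp : ∀ᵐ x ∂m, IsProbabilityMeasure (κ x)) {g : Y → ℝ}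
    (hg : Measurable g) {B : ℝ} (hB : ∀ᵐ x ∂m, ∀ᵐ y ∂κ x, |g y| ≤ B) {h : X → ℝ}
    (hm : AEStronglyMeasurable h m) (hh : ∀ᵐ x ∂m, ∫ y, g y ∂κ x = h x) :
    ∫ y, g y ∂m.bind κ = ∫ x, h x ∂m := by
  have := isProbabilityMeasure_bind_of_ae hκ hp
  have hgB : ∀ᵐ y ∂m.bind κ, |g y| ≤ B :=
    ae_bind_of_ae_ae hκ (s := {y | |g y| ≤ B}) (measurableSet_le hg.abs measurable_const) hB
  have hhB : ∀ᵐ x ∂m, |h x| ≤ B := by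
    filter_upwards [hp, hB, hh] with x h1 h2 h3
    rw [← h3]
    exact abs_integral_le_of_ae_abs_le h2
  have key : ENNReal.ofReal (∫ y, g y ∂m.bind κ + B) = ENNReal.ofReal (∫ x, h x ∂m + B) := by
    rw [ofReal_integral_add_const hg.aestronglyMeasurable hgB, ofReal_integral_add_const hm hhB,
      Measure.lintegral_bind hκ (by fun_prop)]
    refine lintegral_congr_ae ?_
    filter_upwards [hp, hB, hh] with x h1 h2 h3
    rw [← h3, ofReal_integral_add_const hg.aestronglyMeasurable h2]
  have h1 := (abs_le.1 (abs_integral_le_of_ae_abs_le hgB)).1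
  have h2 := (abs_le.1 (abs_integral_le_of_ae_abs_le hhB)).1
  rw [ENNReal.ofReal_eq_ofReal_iff (by linarith) (by linarith)] at key
  linarith

end Bind

/-! ### The law of one private vector -/

section Density

variable {f : ℝ → ℝ}

lemma IsUnitDensity.ae_nonneg (hf : IsUnitDensity f) : 0 ≤ᵐ[unitMeasure] f := by
  filter_upwards [ae_restrict_mem measurableSet_Icc] with x hx using hf.nonneg x hx

lemma IsUnitDensity.isProbabilityMeasure (hf : IsUnitDensity f) :
    IsProbabilityMeasure (densityLaw f) := by
  constructor
  rw [densityLaw, withDensity_apply _ MeasurableSet.univ, Measure.restrict_univ,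
    ← ofReal_integral_eq_lintegral_ofReal hf.integrable hf.ae_nonneg, hf.integral_eq_one,
    ENNReal.ofReal_one]

lemma densityLaw_absolutelyContinuous (f : ℝ → ℝ) : densityLaw f ≪ unitMeasure :=
  withDensity_absolutelyContinuous _ _

lemma ae_densityLaw_mem_Icc (f : ℝ → ℝ) : ∀ᵐ x ∂densityLaw f, x ∈ Set.Icc (0 : ℝ) 1 :=
  (densityLaw_absolutelyContinuous f).ae_le (ae_restrict_mem measurableSet_Icc)

lemma IsUnitDensity.integral_densityLaw (hf : IsUnitDensity f) (g : ℝ → ℝ) :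
    ∫ x, g x ∂densityLaw f = ∫ x in Set.Icc (0 : ℝ) 1, f x * g x := by
  rw [densityLaw, integral_withDensity_eq_integral_toReal_smul₀
    hf.integrable.aemeasurable.ennreal_ofReal (by simp)]
  refine integral_congr_ae ?_
  filter_upwards [hf.ae_nonneg] with x hx
  rw [ENNReal.toReal_ofReal hx, smul_eq_mul]

variable {φ : ℕ → ℝ → ℝ} {k : ℕ} {α B₀ B : ℝ}

lemma aemeasurable_strategyB_comp (hφ : ∀ j, AEMeasurable (φ j) unitMeasure) (f : ℝ → ℝ) :
    AEMeasurable (fun x => strategyB α B₀ B fun j : Fin k => φ j x) (densityLaw f) :=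
  (measurable_strategyB α B₀ B).comp_aemeasurable (aemeasurable_pi_lambda _ fun j =>
    (hφ j).mono_ac (densityLaw_absolutelyContinuous f))

lemma ae_isProbabilityMeasure_strategyB (hk : 0 < k) (hB₀ : 0 < B₀) (hB : 0 < B)
    (hb : ∀ j, ∀ x ∈ Set.Icc (0 : ℝ) 1, |φ j x| ≤ B₀) (f : ℝ → ℝ) :
    ∀ᵐ x ∂densityLaw f, IsProbabilityMeasure (strategyB α B₀ B fun j : Fin k => φ j x) := by
  filter_upwards [ae_densityLaw_mem_Icc f] with x hx
  exact isProbabilityMeasure_strategyB hk α hB₀ hB fun j => hb j x hx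

lemma IsUnitDensity.isProbabilityMeasure_privateLaw (hf : IsUnitDensity f) (hk : 0 < k)
    (hB₀ : 0 < B₀) (hB : 0 < B) (hφ : ∀ j, AEMeasurable (φ j) unitMeasure)
    (hb : ∀ j, ∀ x ∈ Set.Icc (0 : ℝ) 1, |φ j x| ≤ B₀) :
    IsProbabilityMeasure (privateLaw φ f k α B₀ B) := by
  have := hf.isProbabilityMeasure
  exact isProbabilityMeasure_bind_of_ae (aemeasurable_strategyB_comp hφ f)
    (ae_isProbabilityMeasure_strategyB hk hB₀ hB hb f)

lemma abs_apply_le_of_mem_cube {d : ℕ} (hB : 0 < B) {z : Fin d → ℝ} (hz : z ∈ cube d B)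
    (j : Fin d) : |z j| ≤ B := by
  rcases mem_cube.1 hz j with h | h <;> simp [h, abs_of_pos hB]

lemma ae_privateLaw_abs_le (hB : 0 < B) (hφ : ∀ j, AEMeasurable (φ j) unitMeasure) (f : ℝ → ℝ)
    (j : Fin k) : ∀ᵐ z ∂privateLaw φ f k α B₀ B, |z j| ≤ B :=
  ae_bind_of_ae_ae (aemeasurable_strategyB_comp hφ f) (s := {z | |z j| ≤ B})
    (measurableSet_le (by fun_prop) measurable_const) <| .of_forall fun _ =>
      (ae_strategyB _ _ _ _).mono fun _ hz => abs_apply_le_of_mem_cube hB hz j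

lemma IsUnitDensity.integral_privateLaw (hf : IsUnitDensity f)
    (hB₀ : 0 < B₀) (hB : 0 < B) (hφ : ∀ j, AEMeasurable (φ j) unitMeasure)
    (hb : ∀ j, ∀ x ∈ Set.Icc (0 : ℝ) 1, |φ j x| ≤ B₀)
    (hmean : mixtureSlope k α * (B / B₀) = 1) (j : Fin k) :
    ∫ z, z j ∂privateLaw φ f k α B₀ B = basisCoeff φ f j := by
  have := hf.isProbabilityMeasure
  rw [privateLaw, integral_bind_of_bounded (aemeasurable_strategyB_comp hφ f)
    (ae_isProbabilityMeasure_strategyB j.pos hB₀ hB hb f) (measurable_pi_apply j) (B := B)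
    (.of_forall fun _ => (ae_strategyB _ _ _ _).mono fun _ hz => abs_apply_le_of_mem_cube hB hz j)
    (h := φ j) ((hφ j).mono_ac (densityLaw_absolutelyContinuous f)).aestronglyMeasurable,
    hf.integral_densityLaw, basisCoeff]
  filter_upwards [ae_densityLaw_mem_Icc f] with x hx
  rw [integral_strategyB α hB₀ hB fun j => hb j x hx, hmean, one_mul]

end Density

/-! ### Variance of an empirical mean -/

/-- The mean squared error of the empirical mean of an almost surely bounded function. -/
lemma lintegral_sq_sub_mean_pi_le {Ω : Type*} [MeasurableSpace Ω] {μ : Measure Ω}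
    [IsProbabilityMeasure μ] {g : Ω → ℝ} (hg : Measurable g) {B : ℝ}
    (hB : ∀ᵐ z ∂μ, |g z| ≤ B) {n : ℕ} (hn : 0 < n) :
    ∫⁻ Z, ENNReal.ofReal ((∫ z, g z ∂μ - 1 / (n : ℝ) * ∑ i, g (Z i)) ^ 2)
      ∂(Measure.pi fun _ : Fin n => μ) ≤ ENNReal.ofReal (B ^ 2 / n) := by
  have hn' : (n : ℝ) ≠ 0 := by positivity
  set Y : (Fin n → Ω) → ℝ := ∑ i, fun Z => 1 / (n : ℝ) * g (Z i) with hY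
  have hYapp (Z : Fin n → Ω) : Y Z = 1 / (n : ℝ) * ∑ i, g (Z i) := by
    rw [hY, Finset.sum_apply, Finset.mul_sum]
  have hL : MemLp (fun z => 1 / (n : ℝ) * g z) 2 μ :=
    (MemLp.of_bound hg.aestronglyMeasurable B hB).const_mul _
  have hLi (i : Fin n) : MemLp (fun Z : Fin n → Ω => 1 / (n : ℝ) * g (Z i)) 2
      (Measure.pi fun _ : Fin n => μ) :=
    hL.comp_measurePreserving (measurePreserving_eval (fun _ : Fin n => μ) i)
  have hmean : ∫ Z, Y Z ∂(Measure.pi fun _ : Fin n => μ) = ∫ z, g z ∂μ := by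
    simp only [hYapp]
    rw [integral_const_mul, integral_finsetSum]
    · have (i : Fin n) : ∫ Z : Fin n → Ω, g (Z i) ∂(Measure.pi fun _ : Fin n => μ) =
          ∫ z, g z ∂μ :=
        integral_comp_eval (μ := fun _ : Fin n => μ) (i := i) hg.aestronglyMeasurable
      simp [this, hn']
    · intro i _
      exact integrable_comp_eval (μ := fun _ : Fin n => μ) (i := i)
        (Integrable.of_bound hg.aestronglyMeasurable B hB)
  have hvar : Var[Y; Measure.pi fun _ : Fin n => μ] ≤ B ^ 2 / n := by
    rw [hY, variance_sum_pi (μ := fun _ : Fin n => μ) (X := fun _ z => 1 / (n : ℝ) * g z)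
      fun _ => hL]
    have h1 : Var[g; μ] ≤ B ^ 2 := by
      -- Popoviciu's inequality: half the length of `[-B, B]`, squared.
      have := variance_le_sq_of_bounded (μ := μ) (a := -B) (b := B) (X := g)
        (hB.mono fun z hz => abs_le.1 hz) hg.aemeasurable
      calc _ ≤ _ := this
        _ = B ^ 2 := by ring
    simp only [variance_const_mul, Finset.sum_const, Finset.card_univ, Fintype.card_fin,
      nsmul_eq_mul]
    calc (n : ℝ) * ((1 / n) ^ 2 * Var[g; μ]) = Var[g; μ] / n := by field_simp
      _ ≤ _ := by gcongr
  have hYL : MemLp Y 2 (Measure.pi fun _ : Fin n => μ) := memLp_finsetSum' _ fun i _ => hLi i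
  refine le_trans (le_of_eq ?_) (ENNReal.ofReal_le_ofReal hvar)
  rw [hYL.ofReal_variance_eq, evariance_eq_lintegral_ofReal, hmean]
  refine lintegral_congr fun Z => ?_
  rw [← hYapp, ← neg_sub, neg_sq]

/-! ### Parseval's identity and the bias -/

section Parseval

variable {b : HilbertBasis ℕ ℝ (Lp ℝ 2 unitMeasure)} {φ : ℕ → ℝ → ℝ} {f : ℝ → ℝ}

lemma lintegral_sq_eq_tsum_inner (b : HilbertBasis ℕ ℝ (Lp ℝ 2 unitMeasure))
    (g : Lp ℝ 2 unitMeasure) :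
    ∫⁻ x, ENNReal.ofReal (g x ^ 2) ∂unitMeasure =
      ∑' j, ENNReal.ofReal (inner ℝ (b j) g ^ 2) := by
  have h1 := b.hasSum_inner_mul_inner g g
  have h2 : (fun j => inner ℝ g (b j) * inner ℝ (b j) g) = fun j => inner ℝ (b j) g ^ 2 := by
    ext j
    rw [real_inner_comm, sq]
  rw [h2] at h1
  rw [← ENNReal.ofReal_tsum_of_nonneg (fun j => sq_nonneg _) h1.summable, h1.tsum_eq,
    L2.inner_def, ofReal_integral_eq_lintegral_ofReal (L2.integrable_inner g g)]
  · simp [sq]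
  · exact .of_forall fun x => real_inner_self_nonneg

lemma inner_toLp_eq_basisCoeff (hφ : ∀ j, ⇑(b j) =ᵐ[unitMeasure] φ j) (hf : MemLp f 2 unitMeasure)
    (j : ℕ) : inner ℝ (b j) (hf.toLp f) = basisCoeff φ f j := by
  rw [L2.inner_def, basisCoeff]
  refine integral_congr_ae ?_
  filter_upwards [hφ j, hf.coeFn_toLp] with x h1 h2
  simp [h1, h2]

/-- Parseval for the `L²` class of `f` minus the finite sum: only the first `k` coefficients are
changed by the subtraction. -/
lemma lintegral_sq_sub_sum (hφ : ∀ j, ⇑(b j) =ᵐ[unitMeasure] φ j) (hf : MemLp f 2 unitMeasure)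
    {k : ℕ} (a : Fin k → ℝ) :
    ∫⁻ x, ENNReal.ofReal ((f x - ∑ j, a j * φ j x) ^ 2) ∂unitMeasure =
      ∑ j : Fin k, ENNReal.ofReal ((basisCoeff φ f j - a j) ^ 2) +
        ∑' j : ℕ, ENNReal.ofReal (basisCoeff φ f (j + k) ^ 2) := by
  set g : Lp ℝ 2 unitMeasure := hf.toLp f - ∑ j : Fin k, a j • b j with hg
  have hgx : ∀ᵐ x ∂unitMeasure, g x = f x - ∑ j, a j * φ j x := by
    have hs : ∀ᵐ x ∂unitMeasure, ∀ j : Fin k, (a j • b j) x = a j * φ j x := by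
      rw [ae_all_iff]
      intro j
      filter_upwards [Lp.coeFn_smul (a j) (b j), hφ j] with x h1 h2
      rw [h1, Pi.smul_apply, h2, smul_eq_mul]
    filter_upwards [Lp.coeFn_sub (hf.toLp f) (∑ j : Fin k, a j • b j), hf.coeFn_toLp, hs,
      Lp.coeFn_finsetSum Finset.univ fun j : Fin k => a j • b j] with x h1 h2 h3 h4
    rw [hg, h1, Pi.sub_apply, h2, h4]
    simp [h3]
  have hin (l : ℕ) : inner ℝ (b l) g =
      basisCoeff φ f l - ∑ j : Fin k, a j * (if l = j then 1 else 0) := by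
    rw [hg, inner_sub_right, inner_toLp_eq_basisCoeff hφ, inner_sum]
    congr 1
    refine Finset.sum_congr rfl fun j _ => ?_
    rw [inner_smul_right, orthonormal_iff_ite.1 b.orthonormal]
  have h1 : ∫⁻ x, ENNReal.ofReal ((f x - ∑ j, a j * φ j x) ^ 2) ∂unitMeasure =
      ∫⁻ x, ENNReal.ofReal (g x ^ 2) ∂unitMeasure :=
    lintegral_congr_ae (hgx.mono fun x hx => by simp only [hx])
  rw [h1, lintegral_sq_eq_tsum_inner b, ← ENNReal.summable.sum_add_tsum_nat_add' (k := k),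
    Finset.sum_range]
  congr 1
  · refine Finset.sum_congr rfl fun j _ => ?_
    rw [hin]
    simp [← Fin.ext_iff]
  · refine tsum_congr fun j => ?_
    rw [hin, Finset.sum_eq_zero, sub_zero]
    intro i _
    rw [if_neg (by omega), mul_zero]

lemma tsum_tail_sq_le {φ : ℕ → ℝ → ℝ} {β C : ℝ} (hβ : 0 ≤ β) (hf : f ∈ sobolevClass φ β C)
    (k : ℕ) : ∑' j : ℕ, ENNReal.ofReal (basisCoeff φ f (j + k) ^ 2) ≤
      ENNReal.ofReal (((k : ℝ) + 1) ^ (-(2 * β)) * C ^ 2) := by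
  have hw : 0 ≤ ((k : ℝ) + 1) ^ (-(2 * β)) := by positivity
  calc ∑' j : ℕ, ENNReal.ofReal (basisCoeff φ f (j + k) ^ 2)
      ≤ ∑' j : ℕ, ENNReal.ofReal (((k : ℝ) + 1) ^ (-(2 * β))) *
          ENNReal.ofReal ((((j + k : ℕ) : ℝ) + 1) ^ (2 * β) * basisCoeff φ f (j + k) ^ 2) := by
        refine ENNReal.tsum_le_tsum fun j => ?_
        rw [← ENNReal.ofReal_mul hw, ← mul_assoc]
        refine ENNReal.ofReal_le_ofReal (le_mul_of_one_le_left (sq_nonneg _) ?_)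
        rw [Real.rpow_neg (by positivity), inv_mul_eq_div, one_le_div (by positivity)]
        -- Indices start at zero, so the smallest weight in the tail is `(k+1)^(2β)`.
        refine Real.rpow_le_rpow (by positivity) ?_ (by positivity)
        push_cast
        linarith [(Nat.cast_nonneg j : (0 : ℝ) ≤ j)]
    _ ≤ ENNReal.ofReal (((k : ℝ) + 1) ^ (-(2 * β))) * ENNReal.ofReal (C ^ 2) := by
        rw [ENNReal.tsum_mul_left]
        gcongr
        refine le_trans ?_ hf.2
        exact ENNReal.tsum_comp_le_tsum_of_injective (add_left_injective k)
          fun j : ℕ => ENNReal.ofReal (((j : ℝ) + 1) ^ (2 * β) * basisCoeff φ f j ^ 2)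
    _ = _ := (ENNReal.ofReal_mul hw).symm

/-- Otherwise a basis element would vanish almost everywhere, against its unit norm. -/
lemma pos_of_forall_abs_le (hφ : ∀ j, ⇑(b j) =ᵐ[unitMeasure] φ j) {B₀ : ℝ}
    (hb : ∀ j, ∀ x ∈ Set.Icc (0 : ℝ) 1, |φ j x| ≤ B₀) : 0 < B₀ := by
  by_contra! h
  have h0 : b 0 = 0 := by
    rw [Lp.eq_zero_iff_ae_eq_zero]
    filter_upwards [hφ 0, ae_restrict_mem measurableSet_Icc] with x h1 h2
    rw [h1]
    exact abs_nonpos_iff.1 ((hb 0 x h2).trans h)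
  have := b.orthonormal.1 0
  simp [h0] at this

end Parseval

/-! ### Risk bound and choice of the cutoff -/

/-- Variance plus squared bias. The hypothesis `hmean` says that the private coordinates are
unbiased for the basis functions; `mixtureSlope_mul_outerBound` supplies it. -/
lemma privateMSE_le {φ : ℕ → ℝ → ℝ} {f : ℝ → ℝ} {n k : ℕ} {α β C B₀ B : ℝ}
    (hφ : IsOrthonormalBasisL2 φ) (hb : ∀ j, ∀ x ∈ Set.Icc (0 : ℝ) 1, |φ j x| ≤ B₀)
    (hβ : 0 ≤ β) (hf : f ∈ sobolevClass φ β C) (hd : IsUnitDensity f) (hn : 0 < n) (hk : 0 < k)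
    (hB : 0 < B) (hmean : mixtureSlope k α * (B / B₀) = 1) :
    privateMSE φ f n k α B₀ B ≤
      ENNReal.ofReal (k * (B ^ 2 / n) + ((k : ℝ) + 1) ^ (-(2 * β)) * C ^ 2) := by
  obtain ⟨b, hbφ⟩ := hφ
  have hB₀ := pos_of_forall_abs_le hbφ hb
  have hmφ (j) : AEMeasurable (φ j) unitMeasure :=
    (Lp.aestronglyMeasurable (b j)).aemeasurable.congr (hbφ j)
  have := hd.isProbabilityMeasure_privateLaw (α := α) hk hB₀ hB hmφ hb
  have hser (Z : Fin n → Fin k → ℝ) (x : ℝ) : seriesEstimator φ Z x =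
      ∑ j, (1 / (n : ℝ) * ∑ i, Z i j) * φ j x := by
    rw [seriesEstimator, Finset.sum_comm, Finset.mul_sum]
    simp only [Finset.mul_sum, Finset.sum_mul, mul_assoc]
  simp only [privateMSE, hser, lintegral_sq_sub_sum hbφ hf.1]
  rw [lintegral_add_right _ measurable_const, lintegral_finsetSum _ (fun j _ => by fun_prop),
    lintegral_const, measure_univ, mul_one, ENNReal.ofReal_add (by positivity) (by positivity)]
  refine add_le_add ?_ (tsum_tail_sq_le hβ hf k)
  calc _ ≤ ∑ _j : Fin k, ENNReal.ofReal (B ^ 2 / n) := by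
        refine Finset.sum_le_sum fun j _ => ?_
        rw [← hd.integral_privateLaw hB₀ hB hmφ hb hmean j]
        exact lintegral_sq_sub_mean_pi_le (measurable_pi_apply j)
          (ae_privateLaw_abs_le hB hmφ f j) hn
    _ = _ := by
        rw [Finset.sum_const, Finset.card_univ, Fintype.card_fin, nsmul_eq_mul,
          ENNReal.ofReal_mul (Nat.cast_nonneg k), ENNReal.ofReal_natCast]

lemma exp_sub_one_pos {α : ℝ} (hα : 0 < α) : 0 < Real.exp α - 1 := by
  linarith [Real.add_one_lt_exp hα.ne']

lemma outerBound_pos {k : ℕ} (hk : 1 ≤ k) {α B₀ : ℝ} (hα : 0 < α) (hB₀ : 0 < B₀) :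
    0 < outerBound k α B₀ (channelConstant k α) := by
  have hk' : (0 : ℝ) < √(k : ℝ) := Real.sqrt_pos.2 (by exact_mod_cast hk)
  have hc : 0 < channelConstant k α :=
    lt_of_lt_of_le (by norm_num) (five_ninths_le_channelConstant hk hα)
  have := exp_sub_one_pos hα
  unfold outerBound
  positivity

lemma mixtureSlope_mul_outerBound {k : ℕ} (hk : 1 ≤ k) {α B₀ : ℝ} (hα : 0 < α) (hB₀ : 0 < B₀) :
    mixtureSlope k α * (outerBound k α B₀ (channelConstant k α) / B₀) = 1 := by
  have hk' : (0 : ℝ) < √(k : ℝ) := Real.sqrt_pos.2 (by exact_mod_cast hk)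
  have hc : 0 < channelConstant k α :=
    lt_of_lt_of_le (by norm_num) (five_ninths_le_channelConstant hk hα)
  have he := exp_sub_one_pos hα
  have hg : channelConstant k α * (Real.exp α - 1) =
      √(k : ℝ) * mixtureSlope k α * (Real.exp α + 1) := by
    rw [channelConstant, ← sub_div]
    field_simp
  rw [outerBound, hg]
  have hs : mixtureSlope k α ≠ 0 := by
    rintro h
    rw [h] at hg
    simp [hc.ne', he.ne'] at hg
  field_simp

/-- Combines `c_k ≥ 5/9` with `e^α - 1 ≥ α`. The bound `α ≤ α₀` serves only to control the numerator
`e^α + 1`. -/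
lemma outerBound_sq_le {k : ℕ} (hk : 1 ≤ k) {α α₀ B₀ : ℝ} (hα : 0 < α) (hα₀ : α ≤ α₀)
    (hB₀ : 0 < B₀) : outerBound k α B₀ (channelConstant k α) ^ 2 ≤
      (9 / 5 * B₀ * (Real.exp α₀ + 1)) ^ 2 * (k / α ^ 2) := by
  have hc := five_ninths_le_channelConstant hk hα
  have he := Real.add_one_le_exp α
  have h : outerBound k α B₀ (channelConstant k α) ≤
      B₀ * √(k : ℝ) * (Real.exp α₀ + 1) / (5 / 9 * α) := by
    unfold outerBound
    gcongr
    linarith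
  calc _ ≤ (B₀ * √(k : ℝ) * (Real.exp α₀ + 1) / (5 / 9 * α)) ^ 2 :=
        pow_le_pow_left₀ (outerBound_pos hk hα hB₀).le h 2
    _ = (9 / 5 * B₀ * (Real.exp α₀ + 1)) ^ 2 * (√(k : ℝ) ^ 2 / α ^ 2) := by ring
    _ = _ := by rw [Real.sq_sqrt (Nat.cast_nonneg k)]

theorem proposition9 :
    ∃ ck : ℕ → ℝ → ℝ,
      (∀ k : ℕ, 1 ≤ k → ∀ α : ℝ, 0 < α → IsChannelConstant k α (ck k α)) ∧
      ∀ C B₀ α₀ : ℝ, ∃ c : ℝ, 0 < c ∧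
        ∀ β : ℝ, 1 / 2 < β →
        ∀ φ : ℕ → ℝ → ℝ, IsOrthonormalBasisL2 φ →
        (∀ j, ∀ x ∈ Set.Icc (0 : ℝ) 1, |φ j x| ≤ B₀) →
        ∀ f ∈ sobolevClass φ β C, IsUnitDensity f →
        ∀ (n : ℕ) (α : ℝ), 0 < α → α ≤ α₀ → 1 ≤ (n : ℝ) * α ^ 2 →
        ∀ k : ℕ, |(k : ℝ) - ((n : ℝ) * α ^ 2) ^ (1 / (2 * β + 2))| < 1 →
          privateMSE φ f n k α B₀ (outerBound k α B₀ (ck k α)) ≤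
            ENNReal.ofReal (c * ((n : ℝ) * α ^ 2) ^ (-(2 * β / (2 * β + 2)))) := by
  refine ⟨channelConstant, fun k hk α hα => isChannelConstant_channelConstant hk hα, ?_⟩
  intro C B₀ α₀
  -- The first term pays for the variance, with 4 from `k ≤ 2K`, and `C²` for the bias; the added 1
  -- keeps the constant positive even when `B₀ = C = 0`.
  refine ⟨4 * (9 / 5 * B₀ * (Real.exp α₀ + 1)) ^ 2 + C ^ 2 + 1, by positivity, ?_⟩
  intro β hβ φ hφ hb f hf hd n α hα hα₀ hT k hk
  set T : ℝ := (n : ℝ) * α ^ 2 with hTdef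
  set K : ℝ := T ^ (1 / (2 * β + 2)) with hK
  have hT0 : 0 < T := by linarith
  have hK1 : 1 ≤ K := Real.one_le_rpow hT (by positivity)
  have hβ2 : 2 * β + 2 ≠ 0 := by positivity
  -- Either rounding gives `K - 1 < k < K + 1`. With `K ≥ 1` this yields `k > 0`, `k ≤ 2K` for the
  -- variance and `K ≤ k + 1` for the bias.
  have hkK := abs_lt.1 hk
  have hk1 : 1 ≤ k := by
    have : (0 : ℝ) < k := by linarith
    exact_mod_cast this
  have hn : 0 < n := by
    rcases Nat.eq_zero_or_pos n with rfl | h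
    · norm_num [hTdef] at hT
    · exact h
  have hn' : (0 : ℝ) < n := by exact_mod_cast hn
  have hB₀ : 0 < B₀ := hφ.elim fun b hbφ => pos_of_forall_abs_le hbφ hb
  have hrate1 : K ^ 2 / T = T ^ (-(2 * β / (2 * β + 2))) := by
    rw [hK, ← Real.rpow_natCast, ← Real.rpow_mul hT0.le, ← Real.rpow_sub_one hT0.ne']
    congr 1
    push_cast
    field_simp
    ring
  have hrate2 : K ^ (-(2 * β)) = T ^ (-(2 * β / (2 * β + 2))) := by
    rw [hK, ← Real.rpow_mul hT0.le]
    congr 1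
    field_simp
  have hR : 0 < T ^ (-(2 * β / (2 * β + 2))) := by positivity
  refine (privateMSE_le hφ hb (by linarith) hf hd hn hk1 (outerBound_pos hk1 hα hB₀)
    (mixtureSlope_mul_outerBound hk1 hα hB₀)).trans (ENNReal.ofReal_le_ofReal ?_)
  have hvar : (k : ℝ) * (outerBound k α B₀ (channelConstant k α) ^ 2 / n) ≤
      4 * (9 / 5 * B₀ * (Real.exp α₀ + 1)) ^ 2 * T ^ (-(2 * β / (2 * β + 2))) := by
    set D := (9 / 5 * B₀ * (Real.exp α₀ + 1)) ^ 2
    calc (k : ℝ) * (outerBound k α B₀ (channelConstant k α) ^ 2 / n)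
        ≤ k * (D * (k / α ^ 2) / n) := by
          gcongr
          exact outerBound_sq_le hk1 hα hα₀ hB₀
      _ = D * ((k : ℝ) ^ 2 / T) := by
          rw [hTdef]
          field_simp
      _ ≤ D * ((2 * K) ^ 2 / T) := by
          gcongr
          linarith
      _ = 4 * D * (K ^ 2 / T) := by ring
      _ = _ := by rw [hrate1]
  have hbias : ((k : ℝ) + 1) ^ (-(2 * β)) ≤ T ^ (-(2 * β / (2 * β + 2))) := by
    rw [← hrate2]
    exact Real.rpow_le_rpow_of_nonpos (by linarith) (by linarith) (by linarith)
  have hC := mul_le_mul_of_nonneg_right hbias (sq_nonneg C)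
  linarith
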